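/- Let $n,r\ge 1$ and $0\le k\le n$ be integers. A $k$-form monomial in $n$ variables is a form $m=x^\alpha\,dx_\sigma$, where $x^\alpha=x_1^{\alpha_1}\cdots x_n^{\alpha_n}$ and $dx_\sigma=dx_{\sigma_1}\wedge\cdots\wedge dx_{\sigma_k}$ for a set $\sigma=\{\sigma_1<\cdots<\sigma_k\}\subset\{1,\dots,n\}$. Put $\deg m=\sum_i\alpha_i$ and $\operatorname{ldeg} m=\#\{\,i\notin\sigma : \alpha_i=1\,\}$. Let $\mathcal P_r\Lambda^k(\mathbb R^n)$ be the real span of the $k$-form monomials $m$ with $\deg m\le r$, and let $\mathcal H_{r,l}\Lambda^k(\mathbb R^n)$ be the real span of those with $\deg m=r$ and $\operatorname{ldeg} m\ge l$. Let $d$ be the exterior derivative and let $\kappa$ be the Koszul differential, that is, the contraction of a form with the identity vector field $x\mapsto x$. Set $$\mathcal J_r\Lambda^k(\mathbb R^n)=\sum_{l\ge1}\kappa\,\mathcal H_{r+l-1,l}\Lambda^{k+1}(\mathbb R^n),$$ $$\mathcal S_r\Lambda^k(\mathbb R^n)=\mathcal P_r\Lambda^k(\mathbb R^n)+\mathcal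 J_r\Lambda^k(\mathbb R^n)+d\,\mathcal J_{r+1}\Lambda^{k-1}(\mathbb R^n),$$ where the last term is $0$ if $k=0$. Let $f=\{x\in\mathbb R^n : x_i=c\}$ be a coordinate hyperplane, where $1\le i\le n$ and $c\in\mathbb R$. The variables $x_j$, $j\ne i$, are coordinates on $f$; through them $f$ is identified with $\mathbb R^{n-1}$, and $\mathcal S_r\Lambda^k(f)$ is defined by the same formulas in these $n-1$ variables (so it is $0$ if $k=n$, and for $n=1$, $k=0$ it is the space $\mathbb R$ of constants on a point). Let $\operatorname{tr}_f$ be the trace on $f$, that is, the pullback of forms through the inclusion $f\hookrightarrow\mathbb R^n$. Then $$\operatorname{tr}_f\mathcal S_r\Lambda^k(\mathbb R^n)=\mathcal S_r\Lambda^k(f).$$ -/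

import Mathlib

noncomputable section

namespace CubicalForms

/-- Differential `k`-forms on the space `ℝ^ι` with coordinates indexed by `ι`: functions from `ℝ^ι`
to the alternating `k`-linear functionals on `ℝ^ι`. No regularity is imposed here. -/
abbrev Form (ι : Type) [Fintype ι] (k : ℕ) : Type :=
  (ι → ℝ) → (ι → ℝ) [⋀^Fin k]→L[ℝ] ℝ

/-- The pullback of a differential form through a map `φ`, at every point through the derivative
of `φ` (`φ` is meant to be differentiable). -/
def pullback {ι κ : Type} [Fintype ι] [Fintype κ] {k : ℕ}
    (φ : (κ → ℝ) → (ι → ℝ)) (ω : Form ι k) : Form κ k :=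
  fun y => (ω (φ y)).compContinuousLinearMap (fderiv ℝ φ y)

/-- The Koszul differential `κ` from `(k+1)`-forms to `k`-forms: the contraction, in the first
argument, with the identity vector field `x ↦ x`. -/
def koszul (ι : Type) [Fintype ι] (k : ℕ) : Form ι (k + 1) →ₗ[ℝ] Form ι k where
  toFun ω x := (ω x).curryLeft x
  map_add' _ _ := rfl
  map_smul' _ _ := rfl

section Monomials

variable {ι : Type} [LinearOrder ι]

/-- The basic alternator `dx_σ = dx_{σ₁} ∧ ⋯ ∧ dx_{σₖ}`. A subset `σ` of the index set with `k`
elements is given by its increasing enumeration `σ₁ < ⋯ < σₖ`. On vectors `v₁, …, vₖ` its value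
is the determinant of the matrix with entries `dx_{σ_b} (v_a)`. -/
def basicAlternator {k : ℕ} (σ : Fin k ↪o ι) : (ι → ℝ) [⋀^Fin k]→L[ℝ] ℝ :=
  { (Matrix.detRowAlternating (R := ℝ) (n := Fin k)).compLinearMap (LinearMap.funLeft ℝ ℝ σ) with
    cont := by
      change Continuous fun v : Fin k → ι → ℝ => Matrix.det (Matrix.of fun a b => v a (σ b))
      apply Continuous.matrix_det
      fun_prop }

theorem basicAlternator_apply {k : ℕ} (σ : Fin k ↪o ι) (v : Fin k → ι → ℝ) :
    basicAlternator σ v = Matrix.det (Matrix.of fun a b => v a (σ b)) :=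
  rfl

variable [Fintype ι]

/-- The form monomial `x^α dx_σ`. -/
def formMonomial {k : ℕ} (α : ι → ℕ) (σ : Fin k ↪o ι) : Form ι k :=
  fun x => (∏ i, x i ^ α i) • basicAlternator σ

/-- The polynomial degree `|α|` of a form monomial `x^α dx_σ`. -/
def monomialDegree (α : ι → ℕ) : ℕ := ∑ i, α i

/-- The linear degree of the form monomial `x^α dx_σ`: the number of the variables `x_i` with
`i ∉ σ` that enter `x^α` linearly. -/
def linearDegree {k : ℕ} (α : ι → ℕ) (σ : Fin k ↪o ι) : ℕ :=
  (Finset.univ.filter fun i : ι => i ∉ Set.range σ ∧ α i = 1).card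

end Monomials

section Spaces

variable (ι : Type) [Fintype ι] [LinearOrder ι]

/-- The space `𝒫_r Λ^k`: the span of the `k`-form monomials of degree at most `r`. -/
def polyForms (r k : ℕ) : Submodule ℝ (Form ι k) :=
  Submodule.span ℝ
    {m | ∃ (α : ι → ℕ) (σ : Fin k ↪o ι), monomialDegree α ≤ r ∧ m = formMonomial α σ}

/-- The space `ℋ_{r,l} Λ^k` of the homogeneous polynomial `k`-forms of degree `r` all of whose
monomials have linear degree at least `l`. -/
def homForms (r l k : ℕ) : Submodule ℝ (Form ι k) :=
  Submodule.span ℝ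
    {m | ∃ (α : ι → ℕ) (σ : Fin k ↪o ι),
      monomialDegree α = r ∧ l ≤ linearDegree α σ ∧ m = formMonomial α σ}

/-- The space `𝒥_r Λ^k = ∑_{l ≥ 1} κ ℋ_{r+l-1,l} Λ^{k+1}`. -/
def jForms (r k : ℕ) : Submodule ℝ (Form ι k) :=
  ⨆ (l : ℕ) (_ : 1 ≤ l), (homForms ι (r + l - 1) l (k + 1)).map (koszul ι k)

/-- The space `d 𝒥_r Λ^{k-1}` of `k`-forms, which is zero for `k = 0`. Here `d` is the exterior
derivative. It is additive only on differentiable forms, so its image is written as a span; the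
elements of `𝒥_r Λ^{k-1}` are polynomial forms, on which `d` is linear. -/
def dJForms (r : ℕ) : (k : ℕ) → Submodule ℝ (Form ι k)
  | 0 => ⊥
  | k + 1 => Submodule.span ℝ ((fun ω : Form ι k => extDeriv ω) '' (jForms ι r k : Set (Form ι k)))

/-- The space `𝒮_r Λ^k = 𝒫_r Λ^k + 𝒥_r Λ^k + d 𝒥_{r+1} Λ^{k-1}` on `ℝ^ι`. -/
def sForms (r k : ℕ) : Submodule ℝ (Form ι k) :=
  polyForms ι r k ⊔ jForms ι r k ⊔ dJForms ι (r + 1) k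

end Spaces

section Trace

variable {ι : Type} [Fintype ι] [LinearOrder ι]

/-- The inclusion into `ℝ^ι` of the hyperplane `f = {x | x_i = c}`, which has the coordinates
`x_j`, `j ≠ i`. -/
def hyperplaneIncl (i : ι) (c : ℝ) (y : {j : ι // j ≠ i} → ℝ) : ι → ℝ :=
  fun j => if h : j = i then c else y ⟨j, h⟩

/-- The trace on the hyperplane `f = {x | x_i = c}`: the pullback through the inclusion of `f`,
written in the coordinates `x_j`, `j ≠ i`, of `f`. -/
def trace (i : ι) (c : ℝ) (k : ℕ) : Form ι k →ₗ[ℝ] Form {j : ι // j ≠ i} k where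
  toFun ω := pullback (hyperplaneIncl i c) ω
  map_add' _ _ := rfl
  map_smul' _ _ := rfl

end Trace

end CubicalForms

end

/-! Call a monomial m superlinear if deg m < r + ldeg m, and let L_r be the span of these
(`superlinearForms`). Then P_r + J_r = P_r + κ L_r, so one inequality replaces the sum over l.

The key point is that L_r ⊆ S_r (`superlinearForms_le_sForms`). The formulas of Cartan and Euler
give (deg m + k) m = κ d m + d κ m for a k-form monomial m. Differentiating a variable lowers the
degree by one and the linear degree by at most one, so d m is again superlinear and κ d m ∈ P_r +
J_r. Also κ m ∈ S_{r+1}, and d S_{r+1} ⊆ S_r.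

The trace commutes with d, so the J part decides. Let m = x^α dx_σ be superlinear. If i ∉ σ, then tr
κ m is c^(α_i) times κ of the monomial with x_i deleted. If i ∈ σ, only the term of κ m that
contracts dx_i survives, and it gives a multiple of a monomial, not of a κ-image; this is where L_r
⊆ S_r is needed. Deleting x_i lowers the degree by α_i and the linear degree by at most α_i, so the
monomial on f is superlinear in both cases.

For surjectivity, monomials on f are extended with exponent 0 in x_i; on these extensions the trace
commutes with κ. -/

noncomputable section

namespace CubicalForms

/-! ### Exterior multiplication and contraction of basic alternators -/

section Alternators

variable {ι : Type}

/-- The alternating form `dx_{f 0} ∧ ⋯ ∧ dx_{f (k-1)}` for an arbitrary family `f` of indices. -/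
def familyAlternator {k : ℕ} (f : Fin k → ι) : (ι → ℝ) [⋀^Fin k]→L[ℝ] ℝ :=
  { (Matrix.detRowAlternating (R := ℝ) (n := Fin k)).compLinearMap (LinearMap.funLeft ℝ ℝ f) with
    cont := by
      change Continuous fun v : Fin k → ι → ℝ => Matrix.det (Matrix.of fun a b => v a (f b))
      apply Continuous.matrix_det
      fun_prop }

theorem familyAlternator_apply {k : ℕ} (f : Fin k → ι) (v : Fin k → ι → ℝ) :
    familyAlternator f v = Matrix.det (Matrix.of fun a b => v a (f b)) :=
  rfl

theorem familyAlternator_eq_zero {k : ℕ} {f : Fin k → ι} (hf : ¬ Function.Injective f) :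
    familyAlternator f = 0 := by
  simp only [Function.Injective, not_forall] at hf
  obtain ⟨a, b, hab, hne⟩ := hf
  ext v
  rw [familyAlternator_apply]
  exact Matrix.det_zero_of_column_eq hne fun c => by simp [hab]

variable [LinearOrder ι]

/-- The alternator of an injective family is, up to sign, a basic alternator. -/
theorem exists_familyAlternator_eq_smul {k : ℕ} {f : Fin k → ι} (hf : Function.Injective f) :
    ∃ (σ : Fin k ↪o ι) (ε : ℝ),
      Set.range σ = Set.range f ∧ familyAlternator f = ε • basicAlternator σ := by
  have hs : StrictMono (f ∘ Tuple.sort f) :=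
    (Tuple.monotone_sort f).strictMono_of_injective (hf.comp (Tuple.sort f).injective)
  refine ⟨OrderEmbedding.ofStrictMono _ hs, ((Equiv.Perm.sign (Tuple.sort f) : ℤ) : ℝ), ?_, ?_⟩
  · simp [Set.range_comp]
  · ext v
    have h := Matrix.det_permute' (Tuple.sort f) (Matrix.of fun a b => v a (f b))
    rw [familyAlternator_apply, ContinuousAlternatingMap.smul_apply, basicAlternator_apply]
    have h2 : (Matrix.of fun a b => v a ((OrderEmbedding.ofStrictMono _ hs) b)) =
        (Matrix.of fun a b => v a (f b)).submatrix id (Tuple.sort f) := rfl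
    rw [h2, h, smul_eq_mul, ← mul_assoc, ← Int.cast_mul, ← Units.val_mul, Int.units_mul_self]
    simp

variable [Fintype ι]

/-- Exterior multiplication of an alternator by `dx_j`. -/
theorem alternatizeUncurryFin_smulRight {k : ℕ} (j : ι) (σ : Fin k ↪o ι) :
    ContinuousAlternatingMap.alternatizeUncurryFin
      ((ContinuousLinearMap.proj (R := ℝ) (φ := fun _ : ι => ℝ) j).smulRight (basicAlternator σ)) =
      familyAlternator (Fin.cons j σ : Fin (k + 1) → ι) := by
  ext v
  -- Laplace expansion along the column of `j` is the alternating sum defining the wedge product.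
  rw [familyAlternator_apply, Matrix.det_succ_column_zero,
    ContinuousAlternatingMap.alternatizeUncurryFin_apply]
  refine Finset.sum_congr rfl fun a _ => ?_
  simp only [ContinuousLinearMap.smulRight_apply, ContinuousAlternatingMap.smul_apply,
    ContinuousLinearMap.proj_apply, basicAlternator_apply, Matrix.of_apply, Fin.cons_zero]
  rw [zsmul_eq_mul, smul_eq_mul, mul_assoc]
  simp only [Int.cast_pow, Int.cast_neg, Int.cast_one]
  rfl

/-- Contraction of a basic alternator with a vector. -/
theorem curryLeft_basicAlternator {k : ℕ} (σ : Fin (k + 1) ↪o ι) (x : ι → ℝ) :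
    (basicAlternator σ).curryLeft x =
      ∑ b : Fin (k + 1), ((-1) ^ (b : ℕ) * x (σ b)) •
        basicAlternator ((Fin.succAboveOrderEmb b).trans σ) := by
  ext v
  rw [ContinuousAlternatingMap.curryLeft_apply_apply, basicAlternator_apply,
    Matrix.det_succ_row_zero, ContinuousAlternatingMap.sum_apply]
  refine Finset.sum_congr rfl fun b _ => ?_
  rfl

end Alternators

end CubicalForms

end

noncomputable section

namespace CubicalForms

open scoped ContDiff

/-! ### Smooth forms and Cartan's formula -/

section Calculus

variable {ι : Type} [Fintype ι] {k : ℕ}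

/-- The smooth differential forms. -/
def smoothForms (ι : Type) [Fintype ι] (k : ℕ) : Submodule ℝ (Form ι k) where
  carrier := {η | ContDiff ℝ ∞ η}
  add_mem' {a b} (h₁ : ContDiff ℝ ∞ a) (h₂ : ContDiff ℝ ∞ b) := h₁.add h₂
  zero_mem' := (contDiff_const : ContDiff ℝ ∞ fun _ : ι → ℝ => (0 : (ι → ℝ) [⋀^Fin k]→L[ℝ] ℝ))
  smul_mem' c η (h : ContDiff ℝ ∞ η) := h.const_smul c

theorem mem_smoothForms {η : Form ι k} : η ∈ smoothForms ι k ↔ ContDiff ℝ ∞ η :=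
  Iff.rfl

theorem differentiable_of_mem_smoothForms {η : Form ι k} (h : η ∈ smoothForms ι k) :
    Differentiable ℝ η :=
  (mem_smoothForms.1 h).differentiable (by simp)

/-- Contraction in the first argument as a continuous linear map. -/
def curryLeftCLM (ι : Type) [Fintype ι] (k : ℕ) :
    ((ι → ℝ) [⋀^Fin (k + 1)]→L[ℝ] ℝ) →L[ℝ] ((ι → ℝ) →L[ℝ] (ι → ℝ) [⋀^Fin k]→L[ℝ] ℝ) :=
  (ContinuousAlternatingMap.curryLeftLI (𝕜 := ℝ) (E := ι → ℝ) (F := ℝ)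
    (n := k)).toContinuousLinearMap

theorem koszul_mem_smoothForms {η : Form ι (k + 1)} (h : η ∈ smoothForms ι (k + 1)) :
    koszul ι k η ∈ smoothForms ι k := by
  have hC : ContDiff ℝ ∞ (curryLeftCLM ι k) := ContinuousLinearMap.contDiff _
  have h1 : ContDiff ℝ ∞ fun x => (η x).curryLeft := hC.comp (mem_smoothForms.1 h)
  exact h1.clm_apply contDiff_id

theorem extDeriv_mem_smoothForms {η : Form ι k} (h : η ∈ smoothForms ι k) :
    (extDeriv η : Form ι (k + 1)) ∈ smoothForms ι (k + 1) := by
  have h1 : ContDiff ℝ ∞ (fderiv ℝ η) := (mem_smoothForms.1 h).fderiv_right (by simp)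
  exact (ContinuousAlternatingMap.alternatizeUncurryFinCLM ℝ (ι → ℝ) ℝ).contDiff.comp h1

/-- The smooth forms whose exterior derivative belongs to `W`. -/
def extDerivComap (W : Submodule ℝ (Form ι (k + 1))) : Submodule ℝ (Form ι k) where
  carrier := {η | η ∈ smoothForms ι k ∧ (extDeriv η : Form ι (k + 1)) ∈ W}
  add_mem' {a b} ha hb := by
    refine ⟨add_mem ha.1 hb.1, ?_⟩
    have h : extDeriv (a + b) = extDeriv a + extDeriv b := by
      funext x
      exact extDeriv_add (differentiable_of_mem_smoothForms ha.1 x)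
        (differentiable_of_mem_smoothForms hb.1 x)
    rw [h]
    exact add_mem ha.2 hb.2
  zero_mem' := by
    refine ⟨zero_mem _, ?_⟩
    have h : extDeriv (0 : Form ι k) = 0 := by
      funext x
      simpa using extDeriv_smul (x := x) (0 : ℝ) (0 : Form ι k)
    rw [h]
    exact zero_mem _
  smul_mem' c η hη := by
    refine ⟨Submodule.smul_mem _ c hη.1, ?_⟩
    have h : extDeriv (c • η) = c • extDeriv η := funext fun x => extDeriv_smul c η
    rw [h]
    exact Submodule.smul_mem _ c hη.2

/-- Contraction of the exterior derivative with the identity vector field. -/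
theorem koszul_extDeriv_apply (η : Form ι k) (x : ι → ℝ) (v : Fin k → ι → ℝ) :
    koszul ι k (extDeriv η) x v = fderiv ℝ η x x v -
      ∑ a : Fin k, (-1) ^ (a : ℕ) •
        fderiv ℝ η x (v a) (Fin.removeNth a.succ (Fin.cons x v : Fin (k + 1) → ι → ℝ)) := by
  change (extDeriv η x).curryLeft x v = _
  rw [ContinuousAlternatingMap.curryLeft_apply_apply, extDeriv,
    ContinuousAlternatingMap.alternatizeUncurryFin_apply, Fin.sum_univ_succ, sub_eq_add_neg,
    ← Finset.sum_neg_distrib]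
  congr 1
  · simp [Matrix.vecCons, Fin.removeNth_zero]
  · refine Finset.sum_congr rfl fun a _ => ?_
    simp [Matrix.vecCons, pow_succ]

/-- Cartan's formula in form degree 0, where the term d κ is absent. -/
theorem koszul_extDeriv_zero (η : Form ι 0) (x : ι → ℝ) :
    koszul ι 0 (extDeriv η) x = fderiv ℝ η x x := by
  ext v
  rw [koszul_extDeriv_apply]
  simp

/-- Cartan's formula for the identity vector field. -/
theorem koszul_extDeriv_add_extDeriv_koszul {η : Form ι (k + 1)} (x : ι → ℝ)
    (hη : DifferentiableAt ℝ η x) :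
    koszul ι (k + 1) (extDeriv η) x + extDeriv (koszul ι k η) x =
      fderiv ℝ η x x + (k + 1) • η x := by
  -- Product rule for κη = C(η x) x: differentiating the last factor x gives the curried form of η,
  -- whose alternatization is (k + 1) η.
  let C := curryLeftCLM ι k
  have hC : HasFDerivAt C C (η x) := ContinuousLinearMap.hasFDerivAt _
  have h1 : HasFDerivAt (fun y => C (η y)) (C ∘L fderiv ℝ η x) x := by
    exact HasFDerivAt.comp (E := ι → ℝ) (F := (ι → ℝ) [⋀^Fin (k + 1)]→L[ℝ] ℝ)
      (G := (ι → ℝ) →L[ℝ] (ι → ℝ) [⋀^Fin k]→L[ℝ] ℝ) (g := C) (g' := C) x hC hη.hasFDerivAt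
  have h2 := h1.clm_apply (hasFDerivAt_id x)
  have h3 : fderiv ℝ (koszul ι k η) x = _ := h2.fderiv
  have h4 : extDeriv (koszul ι k η) x =
      ContinuousAlternatingMap.alternatizeUncurryFin ((C ∘L fderiv ℝ η x).flip x) +
        (k + 1) • η x := by
    have h5 : C (η x) ∘L ContinuousLinearMap.id ℝ (ι → ℝ) = (η x).curryLeft := rfl
    rw [extDeriv, h3, ContinuousAlternatingMap.alternatizeUncurryFin_add, h5,
      ContinuousAlternatingMap.alternatizeUncurryFin_curryLeft]
    exact add_comm _ _
  rw [h4, ← add_assoc]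
  congr 1
  ext v
  rw [ContinuousAlternatingMap.add_apply, koszul_extDeriv_apply,
    ContinuousAlternatingMap.alternatizeUncurryFin_apply, sub_add_eq_add_sub, sub_eq_iff_eq_add]
  congr 1
  -- The remaining sum in d κ cancels term by term against the one in κ d.
  refine Finset.sum_congr rfl fun a _ => ?_
  congr 1
  change fderiv ℝ η x (v a) (Matrix.vecCons x (Fin.removeNth a v)) = _
  congr 1
  funext b
  refine Fin.cases ?_ (fun b => ?_) b <;> simp [Fin.removeNth]

end Calculus

/-! ### Derivatives and Koszul differentials of form monomials -/

section Monomials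

variable {ι : Type} [Fintype ι] [LinearOrder ι] {k : ℕ}

theorem hasFDerivAt_formMonomial (α : ι → ℕ) (σ : Fin k ↪o ι) (x : ι → ℝ) :
    HasFDerivAt (formMonomial α σ)
      (∑ j, ((α j : ℝ) * ∏ i, x i ^ Function.update α j (α j - 1) i) •
        (ContinuousLinearMap.proj (R := ℝ) (φ := fun _ : ι => ℝ) j).smulRight
          (basicAlternator σ)) x := by
  have h1 : ∀ i ∈ (Finset.univ : Finset ι), HasFDerivAt (fun y : ι → ℝ => y i ^ α i)
      (((α i : ℝ) * x i ^ (α i - 1)) • ContinuousLinearMap.proj (R := ℝ) (φ := fun _ : ι => ℝ) i)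
      x := fun i _ => by
    simpa using (hasFDerivAt_apply (𝕜 := ℝ) i x).pow (α i)
  have h2 := (HasFDerivAt.finsetProd h1).smul_const (basicAlternator σ)
  refine h2.congr_fderiv ?_
  ext v w
  simp only [ContinuousLinearMap.smulRight_apply, sum_apply,
    smul_apply, Finset.sum_smul]
  congr 1
  refine Finset.sum_congr rfl fun j _ => ?_
  rw [← Finset.mul_prod_erase Finset.univ _ (Finset.mem_univ j)]
  have h3 : ∏ i ∈ Finset.univ.erase j, x i ^ Function.update α j (α j - 1) i =
      ∏ i ∈ Finset.univ.erase j, x i ^ α i :=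
    Finset.prod_congr rfl fun i hi => by rw [Function.update_of_ne (Finset.ne_of_mem_erase hi)]
  rw [h3, Function.update_self, smul_smul]
  simp only [ContinuousLinearMap.proj_apply, smul_eq_mul, smul_smul]
  congr 1
  ring

theorem formMonomial_mem_smoothForms (α : ι → ℕ) (σ : Fin k ↪o ι) :
    formMonomial α σ ∈ smoothForms ι k := by
  rw [mem_smoothForms]
  unfold formMonomial
  fun_prop

/-- Euler's formula for a form monomial. -/
theorem fderiv_formMonomial_self (α : ι → ℕ) (σ : Fin k ↪o ι) (x : ι → ℝ) :
    fderiv ℝ (formMonomial α σ) x x = (monomialDegree α : ℝ) • formMonomial α σ x := by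
  rw [(hasFDerivAt_formMonomial α σ x).fderiv, sum_apply, monomialDegree,
    Nat.cast_sum, Finset.sum_smul]
  refine Finset.sum_congr rfl fun j _ => ?_
  rw [smul_apply, ContinuousLinearMap.smulRight_apply, formMonomial, smul_smul,
    smul_smul, ContinuousLinearMap.proj_apply]
  congr 1
  rcases Nat.eq_zero_or_pos (α j) with h0 | h0
  · simp [h0]
  rw [mul_assoc, ← Finset.mul_prod_erase Finset.univ _ (Finset.mem_univ j),
    ← Finset.mul_prod_erase Finset.univ (fun i => x i ^ α i) (Finset.mem_univ j)]
  have h3 : ∏ i ∈ Finset.univ.erase j, x i ^ Function.update α j (α j - 1) i =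
      ∏ i ∈ Finset.univ.erase j, x i ^ α i :=
    Finset.prod_congr rfl fun i hi => by rw [Function.update_of_ne (Finset.ne_of_mem_erase hi)]
  rw [h3, Function.update_self, mul_comm _ (x j), ← mul_assoc (x j), ← pow_succ',
    Nat.sub_add_cancel h0]

/-- The exterior derivative of a form monomial lies in every space containing the monomials
obtained from it by differentiating one of the variables. -/
theorem extDeriv_formMonomial_mem (α : ι → ℕ) (σ : Fin k ↪o ι)
    (W : Submodule ℝ (Form ι (k + 1)))
    (hW : ∀ (j : ι) (τ : Fin (k + 1) ↪o ι), 1 ≤ α j → Set.range τ = insert j (Set.range σ) →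
      formMonomial (Function.update α j (α j - 1)) τ ∈ W) :
    (extDeriv (formMonomial α σ) : Form ι (k + 1)) ∈ W := by
  have h : extDeriv (formMonomial α σ) = ∑ j, (α j : ℝ) • (fun x : ι → ℝ =>
      (∏ i, x i ^ Function.update α j (α j - 1) i) •
        familyAlternator (Fin.cons j σ : Fin (k + 1) → ι)) := by
    funext x
    rw [extDeriv, (hasFDerivAt_formMonomial α σ x).fderiv,
      ← ContinuousAlternatingMap.alternatizeUncurryFinCLM_apply, map_sum, Finset.sum_apply]
    refine Finset.sum_congr rfl fun j _ => ?_
    rw [map_smul, ContinuousAlternatingMap.alternatizeUncurryFinCLM_apply,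
      alternatizeUncurryFin_smulRight, mul_smul]
    rfl
  rw [h]
  refine Submodule.sum_mem _ fun j _ => ?_
  rcases Nat.eq_zero_or_pos (α j) with h0 | h0
  · simp [h0]
  refine Submodule.smul_mem _ _ ?_
  -- Injectivity fails exactly when `j` already occurs in `σ`, and then dx_j ∧ dx_σ = 0.
  by_cases hj : Function.Injective (Fin.cons j σ : Fin (k + 1) → ι)
  · obtain ⟨τ, ε, hτ, hε⟩ := exists_familyAlternator_eq_smul hj
    have h1 : (fun x : ι → ℝ => (∏ i, x i ^ Function.update α j (α j - 1) i) •
        familyAlternator (Fin.cons j σ : Fin (k + 1) → ι)) =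
        ε • formMonomial (Function.update α j (α j - 1)) τ := by
      funext x
      rw [hε, smul_comm]
      rfl
    rw [h1]
    refine Submodule.smul_mem _ _ (hW j τ h0 ?_)
    rw [hτ, Fin.range_cons]
  · simp only [familyAlternator_eq_zero hj, smul_zero]
    exact W.zero_mem

/-- Multiplication of `x^α` by `x_j`. -/
theorem mul_prod_pow_update (α : ι → ℕ) (j : ι) (x : ι → ℝ) :
    x j * ∏ i, x i ^ α i = ∏ i, x i ^ Function.update α j (α j + 1) i := by
  rw [← Finset.mul_prod_erase Finset.univ _ (Finset.mem_univ j),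
    ← Finset.mul_prod_erase Finset.univ (fun i => x i ^ Function.update α j (α j + 1) i)
      (Finset.mem_univ j), Function.update_self, pow_succ', mul_assoc]
  congr 2
  exact Finset.prod_congr rfl fun i hi => by
    rw [Function.update_of_ne (Finset.ne_of_mem_erase hi)]

/-- The Koszul differential of a form monomial. -/
theorem koszul_formMonomial (α : ι → ℕ) (σ : Fin (k + 1) ↪o ι) :
    koszul ι k (formMonomial α σ) = ∑ b : Fin (k + 1), (-1 : ℝ) ^ (b : ℕ) •
      formMonomial (Function.update α (σ b) (α (σ b) + 1))
        ((Fin.succAboveOrderEmb b).trans σ) := by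
  funext x
  change (formMonomial α σ x).curryLeft x = _
  rw [formMonomial, ContinuousAlternatingMap.curryLeft_smul, smul_apply,
    curryLeft_basicAlternator, Finset.smul_sum, Finset.sum_apply]
  refine Finset.sum_congr rfl fun b _ => ?_
  rw [Pi.smul_apply, formMonomial, smul_smul, smul_smul, ← mul_prod_pow_update]
  congr 1
  ring

end Monomials

end CubicalForms

end

noncomputable section

namespace CubicalForms

/-! ### Superlinear monomials lie in 𝒮_r -/

section Spaces

variable {ι : Type} [Fintype ι] [LinearOrder ι]

variable (ι) in
/-- The span of the monomials `m` with `deg m < r + ldeg m`. -/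
def superlinearForms (r k : ℕ) : Submodule ℝ (Form ι k) :=
  Submodule.span ℝ
    {m | ∃ (α : ι → ℕ) (σ : Fin k ↪o ι),
      monomialDegree α < r + linearDegree α σ ∧ m = formMonomial α σ}

theorem formMonomial_mem_superlinearForms {r k : ℕ} {α : ι → ℕ} {σ : Fin k ↪o ι}
    (h : monomialDegree α < r + linearDegree α σ) :
    formMonomial α σ ∈ superlinearForms ι r k :=
  Submodule.subset_span ⟨α, σ, h, rfl⟩

theorem formMonomial_mem_polyForms {r k : ℕ} {α : ι → ℕ} {σ : Fin k ↪o ι}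
    (h : monomialDegree α ≤ r) : formMonomial α σ ∈ polyForms ι r k :=
  Submodule.subset_span ⟨α, σ, h, rfl⟩

theorem monomialDegree_update_add_one (α : ι → ℕ) (j : ι) :
    monomialDegree (Function.update α j (α j + 1)) = monomialDegree α + 1 := by
  rw [monomialDegree, monomialDegree, Finset.sum_update_of_mem (Finset.mem_univ j),
    ← Finset.add_sum_erase Finset.univ α (Finset.mem_univ j), Finset.sdiff_singleton_eq_erase]
  omega

theorem monomialDegree_update_sub_one {α : ι → ℕ} {j : ι} (h : 1 ≤ α j) :
    monomialDegree (Function.update α j (α j - 1)) + 1 = monomialDegree α := by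
  rw [monomialDegree, monomialDegree, Finset.sum_update_of_mem (Finset.mem_univ j),
    ← Finset.add_sum_erase Finset.univ α (Finset.mem_univ j), Finset.sdiff_singleton_eq_erase]
  omega

/-- Only the index `j` can cease to count. Its new exponent is irrelevant, because `j` belongs to
`τ`. -/
theorem linearDegree_le_update_add_one {k : ℕ} (α : ι → ℕ) (j : ι) (a : ℕ) {σ : Fin k ↪o ι}
    {τ : Fin (k + 1) ↪o ι} (hτ : Set.range τ = insert j (Set.range σ)) :
    linearDegree α σ ≤ linearDegree (Function.update α j a) τ + 1 := by
  classical
  unfold linearDegree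
  refine (Finset.card_le_card ?_).trans (Finset.card_insert_le j _)
  intro p hp
  rw [Finset.mem_filter] at hp
  rw [Finset.mem_insert, Finset.mem_filter, hτ]
  by_cases hpj : p = j
  · exact Or.inl hpj
  · refine Or.inr ⟨Finset.mem_univ _, ?_, ?_⟩
    · rintro (h | h)
      exacts [hpj h, hp.2.1 h]
    · rw [Function.update_of_ne hpj]
      exact hp.2.2

theorem superlinearForms_le_smoothForms (r k : ℕ) :
    superlinearForms ι r k ≤ smoothForms ι k := by
  rw [superlinearForms, Submodule.span_le]
  rintro m ⟨α, σ, -, rfl⟩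
  exact formMonomial_mem_smoothForms α σ

theorem koszul_formMonomial_mem_polyForms {r k : ℕ} {α : ι → ℕ} (σ : Fin (k + 1) ↪o ι)
    (h : monomialDegree α < r) : koszul ι k (formMonomial α σ) ∈ polyForms ι r k := by
  rw [koszul_formMonomial]
  refine Submodule.sum_mem _ fun b _ => Submodule.smul_mem _ _ (formMonomial_mem_polyForms ?_)
  rw [monomialDegree_update_add_one]
  omega

theorem jForms_le_map_superlinearForms (r k : ℕ) :
    jForms ι r k ≤ (superlinearForms ι r (k + 1)).map (koszul ι k) := by
  refine iSup₂_le fun l hl => Submodule.map_mono (Submodule.span_mono ?_)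
  rintro m ⟨α, σ, h1, h2, rfl⟩
  exact ⟨α, σ, by omega, rfl⟩

/-- A superlinear monomial of degree at least r fits the summand l = deg - r + 1 of 𝒥_r. In lower
degree this l could fail l ≥ 1, but there κ gives polynomial degree at most r. -/
theorem map_superlinearForms_le (r k : ℕ) :
    (superlinearForms ι r (k + 1)).map (koszul ι k) ≤ polyForms ι r k ⊔ jForms ι r k := by
  rw [superlinearForms, Submodule.map_span_le]
  rintro m ⟨α, σ, h, rfl⟩
  rcases lt_or_ge (monomialDegree α) r with h1 | h1
  · exact Submodule.mem_sup_left (koszul_formMonomial_mem_polyForms σ h1)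
  · refine Submodule.mem_sup_right ?_
    have h2 : 1 ≤ monomialDegree α - r + 1 := by omega
    refine Submodule.mem_iSup_of_mem (monomialDegree α - r + 1)
      (Submodule.mem_iSup_of_mem h2 (Submodule.mem_map_of_mem (Submodule.subset_span ?_)))
    exact ⟨α, σ, by omega, by omega, rfl⟩

theorem jForms_le_smoothForms (r k : ℕ) : jForms ι r k ≤ smoothForms ι k := by
  refine (jForms_le_map_superlinearForms r k).trans ?_
  rw [Submodule.map_le_iff_le_comap]
  exact fun η hη => koszul_mem_smoothForms (superlinearForms_le_smoothForms _ _ hη)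

theorem map_superlinearForms_le_sForms (r k : ℕ) :
    (superlinearForms ι r (k + 1)).map (koszul ι k) ≤ sForms ι r k :=
  (map_superlinearForms_le r k).trans le_sup_left

theorem polyForms_le_sForms (r k : ℕ) : polyForms ι r k ≤ sForms ι r k :=
  le_sup_left.trans le_sup_left

theorem polyForms_succ_le_extDerivComap (r k : ℕ) :
    polyForms ι (r + 1) k ≤ extDerivComap (sForms ι r (k + 1)) := by
  rw [polyForms, Submodule.span_le]
  rintro m ⟨α, σ, h, rfl⟩
  refine ⟨formMonomial_mem_smoothForms α σ, extDeriv_formMonomial_mem α σ _ fun j τ hj hτ => ?_⟩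
  refine polyForms_le_sForms r _ (formMonomial_mem_polyForms ?_)
  have := monomialDegree_update_sub_one hj
  omega

/-- The exterior derivative maps `𝒮_{r+1} Λ^k` to `𝒮_r Λ^{k+1}`. -/
theorem sForms_succ_le_extDerivComap (r k : ℕ) :
    sForms ι (r + 1) k ≤ extDerivComap (sForms ι r (k + 1)) := by
  refine sup_le (sup_le (polyForms_succ_le_extDerivComap r k) fun η hη => ?_) ?_
  · refine ⟨jForms_le_smoothForms _ _ hη, Submodule.mem_sup_right ?_⟩
    exact Submodule.subset_span ⟨η, hη, rfl⟩
  · cases k with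
    | zero => exact bot_le
    | succ k =>
      refine Submodule.span_le.2 ?_
      rintro _ ⟨η, hη, rfl⟩
      have h1 := jForms_le_smoothForms _ _ hη
      refine ⟨extDeriv_mem_smoothForms h1, ?_⟩
      -- The summand d 𝒥 is killed by d ∘ d = 0.
      rw [extDeriv_extDeriv (contDiff_infty.1 (mem_smoothForms.1 h1) 2) (by simp)]
      exact zero_mem _

/-- The monomials of large linear degree belong to `𝒮_r Λ^k`. -/
theorem superlinearForms_le_sForms (r k : ℕ) : superlinearForms ι r k ≤ sForms ι r k := by
  rw [superlinearForms, Submodule.span_le]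
  rintro m ⟨α, σ, h, rfl⟩
  have hd : (extDeriv (formMonomial α σ) : Form ι (k + 1)) ∈ superlinearForms ι r (k + 1) := by
    refine extDeriv_formMonomial_mem α σ _ fun j τ hj hτ => formMonomial_mem_superlinearForms ?_
    have h1 := monomialDegree_update_sub_one hj
    have h2 := linearDegree_le_update_add_one α j (α j - 1) hτ
    omega
  have hκd := map_superlinearForms_le_sForms r k (Submodule.mem_map_of_mem hd)
  -- The factor deg m + k has to be divided out; it vanishes only for the constant 0-form, which
  -- lies in 𝒫_r.
  rcases Nat.eq_zero_or_pos (monomialDegree α + k) with h0 | h0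
  · exact polyForms_le_sForms r k (formMonomial_mem_polyForms (by omega))
  have hne : ((monomialDegree α + k : ℕ) : ℝ) ≠ 0 := Nat.cast_ne_zero.2 h0.ne'
  suffices hs : ((monomialDegree α + k : ℕ) : ℝ) • formMonomial α σ ∈ sForms ι r k from
    ((sForms ι r k).smul_mem_iff hne).1 hs
  cases k with
  | zero =>
    convert hκd using 1
    funext x
    rw [koszul_extDeriv_zero, fderiv_formMonomial_self]
    rfl
  | succ k =>
    have hdκ : (extDeriv (koszul ι k (formMonomial α σ)) : Form ι (k + 1)) ∈
        sForms ι r (k + 1) := by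
      -- Superlinearity for r implies it for r + 1; the index raised here is lowered again by d.
      refine (sForms_succ_le_extDerivComap r k (map_superlinearForms_le_sForms (r + 1) k
        (Submodule.mem_map_of_mem ?_))).2
      exact formMonomial_mem_superlinearForms (by omega)
    convert add_mem hκd hdκ using 1
    funext x
    rw [Pi.add_apply, koszul_extDeriv_add_extDeriv_koszul x
      (differentiable_of_mem_smoothForms (formMonomial_mem_smoothForms α σ) x),
      fderiv_formMonomial_self, ← Nat.cast_smul_eq_nsmul ℝ, ← add_smul, ← Nat.cast_add]
    rfl

end Spaces

end CubicalForms

end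

noncomputable section

namespace CubicalForms

/-! ### Traces on a coordinate hyperplane -/

section Trace

variable {ι : Type} [Fintype ι] [LinearOrder ι]

/-- The derivative of the inclusion of the hyperplane `{x | x_i = c}`. -/
def hyperplaneInclDeriv (i : ι) : ({j : ι // j ≠ i} → ℝ) →L[ℝ] (ι → ℝ) :=
  ContinuousLinearMap.pi fun j =>
    if h : j = i then 0 else ContinuousLinearMap.proj (R := ℝ) (φ := fun _ => ℝ) ⟨j, h⟩

omit [Fintype ι] in
theorem hyperplaneInclDeriv_apply_self (i : ι) (v : {j : ι // j ≠ i} → ℝ) :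
    hyperplaneInclDeriv i v i = 0 := by
  simp [hyperplaneInclDeriv]

omit [Fintype ι] in
theorem hyperplaneInclDeriv_apply_coe (i : ι) (v : {j : ι // j ≠ i} → ℝ) (j : {j : ι // j ≠ i}) :
    hyperplaneInclDeriv i v j = v j := by
  simp [hyperplaneInclDeriv, j.2]

omit [Fintype ι] in
theorem hyperplaneIncl_apply_self (i : ι) (c : ℝ) (y : {j : ι // j ≠ i} → ℝ) :
    hyperplaneIncl i c y i = c := by
  simp [hyperplaneIncl]

omit [Fintype ι] in
theorem hyperplaneIncl_apply_coe (i : ι) (c : ℝ) (y : {j : ι // j ≠ i} → ℝ)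
    (j : {j : ι // j ≠ i}) : hyperplaneIncl i c y j = y j := by
  simp [hyperplaneIncl, j.2]

theorem hasFDerivAt_hyperplaneIncl (i : ι) (c : ℝ) (y : {j : ι // j ≠ i} → ℝ) :
    HasFDerivAt (hyperplaneIncl i c) (hyperplaneInclDeriv i) y := by
  rw [hasFDerivAt_pi']
  intro j
  by_cases h : j = i
  · subst h
    simp only [hyperplaneIncl_apply_self]
    refine (hasFDerivAt_const c y).congr_fderiv ?_
    ext v
    exact (hyperplaneInclDeriv_apply_self j _).symm
  · have h1 : (fun x => hyperplaneIncl i c x j) = fun x => x ⟨j, h⟩ :=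
      funext fun x => hyperplaneIncl_apply_coe i c x ⟨j, h⟩
    rw [h1]
    refine (hasFDerivAt_apply (𝕜 := ℝ) (⟨j, h⟩ : {j : ι // j ≠ i}) y).congr_fderiv ?_
    ext v
    exact (hyperplaneInclDeriv_apply_coe i _ ⟨j, h⟩).symm

theorem trace_apply (i : ι) (c : ℝ) {k : ℕ} (η : Form ι k) (y : {j : ι // j ≠ i} → ℝ) :
    trace i c k η y = (η (hyperplaneIncl i c y)).compContinuousLinearMap
      (hyperplaneInclDeriv i) := by
  rw [← (hasFDerivAt_hyperplaneIncl i c y).fderiv]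
  rfl

theorem trace_extDeriv (i : ι) (c : ℝ) {k : ℕ} {η : Form ι k} (hη : η ∈ smoothForms ι k) :
    trace i c (k + 1) (extDeriv η) = extDeriv (trace i c k η) := by
  funext y
  have hf : ContDiff ℝ 2 (hyperplaneIncl i c) := by
    refine contDiff_pi.2 fun j => ?_
    unfold hyperplaneIncl
    by_cases h : j = i
    · simp only [h, dif_pos]
      exact contDiff_const
    · simp only [h, dif_neg, not_false_iff]
      exact contDiff_apply ℝ ℝ (⟨j, h⟩ : {j : ι // j ≠ i})
  exact (extDeriv_pullback (differentiable_of_mem_smoothForms hη _) hf.contDiffAt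
    (by simp)).symm

theorem prod_hyperplaneIncl_pow (i : ι) (c : ℝ) (α : ι → ℕ) (y : {j : ι // j ≠ i} → ℝ) :
    ∏ j, hyperplaneIncl i c y j ^ α j = c ^ α i * ∏ j : {j : ι // j ≠ i}, y j ^ α j := by
  rw [Fintype.prod_eq_mul_prod_subtype_ne _ i, hyperplaneIncl_apply_self]
  congr 1
  exact Finset.prod_congr rfl fun j _ => by rw [hyperplaneIncl_apply_coe]

theorem monomialDegree_eq_add (i : ι) (α : ι → ℕ) :
    monomialDegree α = α i + monomialDegree fun j : {j : ι // j ≠ i} => α j :=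
  Fintype.sum_eq_add_sum_subtype_ne _ i

/-- Lift of an increasing family of indices from the hyperplane. -/
def liftIndices (i : ι) {k : ℕ} (τ : Fin k ↪o {j : ι // j ≠ i}) : Fin k ↪o ι :=
  τ.trans (OrderEmbedding.subtype _)

omit [Fintype ι] in
theorem liftIndices_apply (i : ι) {k : ℕ} (τ : Fin k ↪o {j : ι // j ≠ i}) (a : Fin k) :
    liftIndices i τ a = τ a :=
  rfl

omit [Fintype ι] in
theorem exists_eq_liftIndices {i : ι} {k : ℕ} {σ : Fin k ↪o ι} (h : i ∉ Set.range σ) :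
    ∃ τ : Fin k ↪o {j : ι // j ≠ i}, liftIndices i τ = σ := by
  refine ⟨OrderEmbedding.ofStrictMono (fun a => ⟨σ a, fun ha => h ⟨a, ha⟩⟩)
    fun a b hab => σ.strictMono hab, ?_⟩
  ext a
  rfl

theorem trace_formMonomial_liftIndices (i : ι) (c : ℝ) {k : ℕ} (α : ι → ℕ)
    (τ : Fin k ↪o {j : ι // j ≠ i}) :
    trace i c k (formMonomial α (liftIndices i τ)) =
      c ^ α i • formMonomial (fun j : {j : ι // j ≠ i} => α j) τ := by
  funext y
  ext v
  rw [trace_apply, formMonomial, prod_hyperplaneIncl_pow, Pi.smul_apply, formMonomial, smul_smul]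
  simp only [ContinuousAlternatingMap.compContinuousLinearMap_apply,
    ContinuousAlternatingMap.smul_apply, basicAlternator_apply, Function.comp_apply,
    liftIndices_apply, hyperplaneInclDeriv_apply_coe]

theorem trace_formMonomial_of_mem (i : ι) (c : ℝ) {k : ℕ} (α : ι → ℕ) {σ : Fin k ↪o ι}
    (h : i ∈ Set.range σ) : trace i c k (formMonomial α σ) = 0 := by
  obtain ⟨p, rfl⟩ := h
  funext y
  ext v
  rw [trace_apply, formMonomial]
  simp only [ContinuousAlternatingMap.compContinuousLinearMap_apply,
    ContinuousAlternatingMap.smul_apply, basicAlternator_apply]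
  rw [Matrix.det_eq_zero_of_column_eq_zero p, smul_zero]
  · rfl
  · exact fun a => hyperplaneInclDeriv_apply_self _ _

/-- The identity field need not be tangent to the hyperplane, but its normal component is invisible
to dx_σ without the factor dx_i. -/
theorem trace_koszul_formMonomial_liftIndices (i : ι) (c : ℝ) {k : ℕ} (α : ι → ℕ)
    (τ : Fin (k + 1) ↪o {j : ι // j ≠ i}) :
    trace i c k (koszul ι k (formMonomial α (liftIndices i τ))) =
      c ^ α i • koszul _ k (formMonomial (fun j : {j : ι // j ≠ i} => α j) τ) := by
  funext y
  ext v
  rw [trace_apply]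
  change formMonomial α (liftIndices i τ) (hyperplaneIncl i c y)
    (Matrix.vecCons (hyperplaneIncl i c y) (hyperplaneInclDeriv i ∘ v)) =
      c ^ α i • formMonomial (fun j : {j : ι // j ≠ i} => α j) τ y (Matrix.vecCons y v)
  rw [formMonomial, prod_hyperplaneIncl_pow, formMonomial, ContinuousAlternatingMap.smul_apply,
    ContinuousAlternatingMap.smul_apply, smul_smul, basicAlternator_apply, basicAlternator_apply]
  congr 3
  funext a b
  refine Fin.cases ?_ (fun a => ?_) a
  · exact hyperplaneIncl_apply_coe i c y _
  · exact hyperplaneInclDeriv_apply_coe i _ _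

/-- If `dx_i` is a factor of the monomial `m`, then the trace of `κ m` is a multiple of a
monomial. -/
theorem trace_koszul_formMonomial_of_mem (i : ι) (c : ℝ) {k : ℕ} (α : ι → ℕ)
    {σ : Fin (k + 1) ↪o ι} (h : i ∈ Set.range σ) :
    ∃ (τ : Fin k ↪o {j : ι // j ≠ i}) (a : ℝ), Set.range (liftIndices i τ) ⊆ Set.range σ ∧
      trace i c k (koszul ι k (formMonomial α σ)) =
        a • formMonomial (fun j : {j : ι // j ≠ i} => α j) τ := by
  obtain ⟨p, rfl⟩ := h
  have hp : σ p ∉ Set.range ((Fin.succAboveOrderEmb p).trans σ) := by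
    rintro ⟨b, hb⟩
    exact Fin.succAbove_ne p b (σ.injective hb)
  obtain ⟨τ, hτ⟩ := exists_eq_liftIndices hp
  -- The extra power of c is the factor x_i produced by contracting dx_i, which sits at position
  -- `p`.
  refine ⟨τ, (-1) ^ (p : ℕ) * c ^ (α (σ p) + 1), ?_, ?_⟩
  · rw [hτ]
    rintro _ ⟨b, rfl⟩
    exact ⟨_, rfl⟩
  · rw [koszul_formMonomial, map_sum, Finset.sum_eq_single p]
    · rw [map_smul, ← hτ, trace_formMonomial_liftIndices, smul_smul, Function.update_self]
      congr 2
      funext j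
      exact Function.update_of_ne j.2 _ _
    -- Contracting any other factor leaves dx_i in place, so the trace vanishes.
    · intro b _ hb
      rw [map_smul, trace_formMonomial_of_mem, smul_zero]
      obtain ⟨a, ha⟩ := Fin.exists_succAbove_eq hb.symm
      exact ⟨a, congrArg σ ha⟩
    · exact fun hn => absurd (Finset.mem_univ p) hn

/-- The index `i` contributes at most one, and only if α_i = 1. The bound α_i matches the drop in
degree, so superlinearity passes to the hyperplane. -/
theorem linearDegree_le_add {i : ι} {k l : ℕ} (α : ι → ℕ) {σ : Fin l ↪o ι}
    {τ : Fin k ↪o {j : ι // j ≠ i}} (h : Set.range (liftIndices i τ) ⊆ Set.range σ) :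
    linearDegree α σ ≤ α i + linearDegree (fun j : {j : ι // j ≠ i} => α j) τ := by
  classical
  have h1 : (Finset.univ.filter fun j : ι => j ∉ Set.range σ ∧ α j = 1) ⊆
      (({i} : Finset ι).filter fun j => α j = 1) ∪
        (Finset.univ.filter fun j : {j : ι // j ≠ i} => j ∉ Set.range τ ∧ α j = 1).map
          (Function.Embedding.subtype _) := by
    intro p hp
    obtain ⟨-, hp1, hp2⟩ := Finset.mem_filter.1 hp
    by_cases hpi : p = i
    · exact Finset.mem_union_left _ (Finset.mem_filter.2 ⟨Finset.mem_singleton.2 hpi, hp2⟩)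
    · refine Finset.mem_union_right _ (Finset.mem_map.2 ⟨⟨p, hpi⟩, Finset.mem_filter.2
        ⟨Finset.mem_univ _, ?_, hp2⟩, rfl⟩)
      rintro ⟨a, ha⟩
      exact hp1 (h ⟨a, congrArg Subtype.val ha⟩)
  have h2 : (({i} : Finset ι).filter fun j => α j = 1).card ≤ α i := by
    rw [Finset.filter_singleton]
    split_ifs with hi <;> simp [hi]
  unfold linearDegree
  refine (Finset.card_le_card h1).trans ((Finset.card_union_le _ _).trans ?_)
  rw [Finset.card_map]
  exact Nat.add_le_add_right h2 _

/-- The extension of a multi-index from the hyperplane by zero. -/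
def extendExponents (i : ι) (α : {j : ι // j ≠ i} → ℕ) (j : ι) : ℕ :=
  if h : j = i then 0 else α ⟨j, h⟩

omit [Fintype ι] in
theorem extendExponents_self (i : ι) (α : {j : ι // j ≠ i} → ℕ) :
    extendExponents i α i = 0 := by
  simp [extendExponents]

omit [Fintype ι] in
theorem extendExponents_coe (i : ι) (α : {j : ι // j ≠ i} → ℕ) (j : {j : ι // j ≠ i}) :
    extendExponents i α j = α j := by
  simp [extendExponents, j.2]

theorem monomialDegree_extendExponents (i : ι) (α : {j : ι // j ≠ i} → ℕ) :
    monomialDegree (extendExponents i α) = monomialDegree α := by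
  rw [monomialDegree_eq_add i]
  simp only [extendExponents_self, extendExponents_coe, zero_add]

theorem linearDegree_le_extendExponents {i : ι} {k : ℕ} (α : {j : ι // j ≠ i} → ℕ)
    (τ : Fin k ↪o {j : ι // j ≠ i}) :
    linearDegree α τ ≤ linearDegree (extendExponents i α) (liftIndices i τ) := by
  classical
  unfold linearDegree
  rw [← Finset.card_map (Function.Embedding.subtype _)]
  refine Finset.card_le_card fun p hp => ?_
  obtain ⟨q, hq, rfl⟩ := Finset.mem_map.1 hp
  obtain ⟨-, hq1, hq2⟩ := Finset.mem_filter.1 hq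
  refine Finset.mem_filter.2 ⟨Finset.mem_univ _, ?_, (extendExponents_coe i α q).trans hq2⟩
  rintro ⟨a, ha⟩
  exact hq1 ⟨a, Subtype.ext ha⟩

theorem map_trace_polyForms_le (i : ι) (c : ℝ) (r k : ℕ) :
    (polyForms ι r k).map (trace i c k) ≤ polyForms {j : ι // j ≠ i} r k := by
  rw [polyForms, Submodule.map_span_le]
  rintro m ⟨α, σ, h, rfl⟩
  by_cases hi : i ∈ Set.range σ
  · rw [trace_formMonomial_of_mem i c α hi]
    exact zero_mem _
  · obtain ⟨τ, rfl⟩ := exists_eq_liftIndices hi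
    rw [trace_formMonomial_liftIndices]
    refine Submodule.smul_mem _ _ (formMonomial_mem_polyForms ?_)
    have := monomialDegree_eq_add i α
    omega

/-- The target is all of 𝒮_r and not 𝒫_r + 𝒥_r: monomials containing dx_i yield superlinear
monomials, whose membership uses the summand d 𝒥_{r+1}. -/
theorem map_trace_jForms_le (i : ι) (c : ℝ) (r k : ℕ) :
    (jForms ι r k).map (trace i c k) ≤ sForms {j : ι // j ≠ i} r k := by
  refine (Submodule.map_mono (jForms_le_map_superlinearForms r k)).trans ?_
  rw [← Submodule.map_comp, superlinearForms, Submodule.map_span_le]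
  rintro m ⟨α, σ, h, rfl⟩
  rw [LinearMap.comp_apply]
  have hdeg := monomialDegree_eq_add i α
  by_cases hi : i ∈ Set.range σ
  · obtain ⟨τ, a, hτ, h1⟩ := trace_koszul_formMonomial_of_mem i c α hi
    rw [h1]
    have hl := linearDegree_le_add α hτ
    exact Submodule.smul_mem _ _ (superlinearForms_le_sForms r k
      (formMonomial_mem_superlinearForms (by omega)))
  · obtain ⟨τ, rfl⟩ := exists_eq_liftIndices hi
    rw [trace_koszul_formMonomial_liftIndices]
    have hl := linearDegree_le_add (τ := τ) α subset_rfl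
    exact Submodule.smul_mem _ _ (map_superlinearForms_le_sForms r k (Submodule.mem_map_of_mem
      (formMonomial_mem_superlinearForms (by omega))))

theorem map_trace_dJForms_le (i : ι) (c : ℝ) (r k : ℕ) :
    (dJForms ι (r + 1) k).map (trace i c k) ≤ sForms {j : ι // j ≠ i} r k := by
  cases k with
  | zero => exact (Submodule.map_bot _).trans_le bot_le
  | succ k =>
    refine (Submodule.map_span_le _ _ _).2 ?_
    rintro _ ⟨η, hη, rfl⟩
    rw [trace_extDeriv i c (jForms_le_smoothForms _ _ hη)]
    exact (sForms_succ_le_extDerivComap r k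
      (map_trace_jForms_le i c (r + 1) k (Submodule.mem_map_of_mem hη))).2

theorem map_trace_sForms_le (i : ι) (c : ℝ) (r k : ℕ) :
    (sForms ι r k).map (trace i c k) ≤ sForms {j : ι // j ≠ i} r k := by
  rw [sForms, Submodule.map_sup, Submodule.map_sup]
  exact sup_le (sup_le ((map_trace_polyForms_le i c r k).trans (polyForms_le_sForms r k))
    (map_trace_jForms_le i c r k)) (map_trace_dJForms_le i c r k)

theorem polyForms_le_map_trace (i : ι) (c : ℝ) (r k : ℕ) :
    polyForms {j : ι // j ≠ i} r k ≤ (polyForms ι r k).map (trace i c k) := by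
  refine Submodule.span_le.2 ?_
  rintro m ⟨α, τ, h, rfl⟩
  refine ⟨formMonomial (extendExponents i α) (liftIndices i τ),
    formMonomial_mem_polyForms (by rwa [monomialDegree_extendExponents]), ?_⟩
  rw [trace_formMonomial_liftIndices]
  simp only [extendExponents_self, extendExponents_coe, pow_zero, one_smul]

theorem jForms_le_map_trace (i : ι) (c : ℝ) (r k : ℕ) :
    jForms {j : ι // j ≠ i} r k ≤
      ((superlinearForms ι r (k + 1)).map (koszul ι k)).map (trace i c k) := by
  refine (jForms_le_map_superlinearForms r k).trans ((Submodule.map_span_le _ _ _).2 ?_)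
  rintro m ⟨α, τ, h, rfl⟩
  refine ⟨_, Submodule.mem_map_of_mem (formMonomial_mem_superlinearForms
    (α := extendExponents i α) (σ := liftIndices i τ) ?_), ?_⟩
  · have := linearDegree_le_extendExponents α τ
    rw [monomialDegree_extendExponents]
    omega
  · rw [trace_koszul_formMonomial_liftIndices]
    simp only [extendExponents_self, extendExponents_coe, pow_zero, one_smul]

/-- A preimage ζ of a form in 𝒥_{r+1} is found in κ L_{r+1} ⊆ 𝒮_{r+1}; then dζ ∈ 𝒮_r has the
required trace. -/
theorem dJForms_le_map_trace (i : ι) (c : ℝ) (r k : ℕ) :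
    dJForms {j : ι // j ≠ i} (r + 1) k ≤ (sForms ι r k).map (trace i c k) := by
  cases k with
  | zero => exact bot_le
  | succ k =>
    refine Submodule.span_le.2 ?_
    rintro _ ⟨η, hη, rfl⟩
    obtain ⟨ζ, hζ, rfl⟩ := jForms_le_map_trace i c (r + 1) k hη
    have h := sForms_succ_le_extDerivComap r k (map_superlinearForms_le_sForms (r + 1) k hζ)
    exact ⟨_, h.2, trace_extDeriv i c h.1⟩

/-- The trace maps `𝒮_r Λ^k` onto the corresponding space on the hyperplane. -/
theorem map_trace_sForms (i : ι) (c : ℝ) (r k : ℕ) :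
    (sForms ι r k).map (trace i c k) = sForms {j : ι // j ≠ i} r k := by
  refine le_antisymm (map_trace_sForms_le i c r k) (sup_le (sup_le ?_ ?_) ?_)
  · exact (polyForms_le_map_trace i c r k).trans (Submodule.map_mono (polyForms_le_sForms r k))
  · exact (jForms_le_map_trace i c r k).trans
      (Submodule.map_mono (map_superlinearForms_le_sForms r k))
  · exact dJForms_le_map_trace i c r k

end Trace

end CubicalForms

end

theorem mainTheorem5 (n r k : ℕ) (hn : 1 ≤ n) (hr : 1 ≤ r) (hk : k ≤ n) (i : Fin n) (c : ℝ) :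
    (CubicalForms.sForms (Fin n) r k).map (CubicalForms.trace i c k) =
      CubicalForms.sForms {j : Fin n // j ≠ i} r k := by
  exact CubicalForms.map_trace_sForms i c r k
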